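/- Let $d\ge 1$, let $\Omega\subset\mathbb R^d$ be a bounded domain (open and connected), and let $y_d\in L^2(\Omega)$. Let $g:\mathbb R\to\mathbb R\cup\{+\infty\}$ be proper and lower semicontinuous with $\lim_{|v|\to\infty} g(v)/|v|=+\infty$. For $y\in L^2(\Omega)$ and a control $u$ put $$J(y,u):=\tfrac12\|y-y_d\|_{L^2(\Omega)}^2+\int_\Omega g(u(x))\,dx .$$ Call a control $u$ feasible if $\int_\Omega g(u)\,dx$ exists and is finite. Then there are $\gamma>0$ and $c>0$ such that the following holds for all feasible $u,\tilde u\in L^\infty(\Omega)$ and all measurable $B\subset\Omega$ (that is, $\gamma$ and $c$ are independent of $u,\tilde u,B$). Let $u_B:=u+\chi_B(\tilde u-u)$, and let $y,y_B,p\in H^1_0(\Omega)$ be the weak solutions, with homogeneous Dirichlet boundary conditions on $\partial\Omega$, of $$-\Delta y=u,\qquad -\Delta y_B=u_B,\qquad -\Delta p=y-y_d\qquad\text{in }\Omega .$$ Then $$J(y_B,u_B)-J(y,u)\le\int_B\big[(\tilde u-u)\,p+g(\tilde u)-g(u)\big]\,dx+c\,|B|^{1+\gamma}\,\|\tilde u-u\|_{L^\infty(\Omega)}^2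 ,$$ where $|B|$ denotes the Lebesgue measure of $B$. -/

import Mathlib

open MeasureTheory Filter Topology
open scoped ContDiff

namespace EllipticControl

/-- `ℝᵈ` with the Euclidean norm. -/
abbrev Sp (d : ℕ) : Type := EuclideanSpace ℝ (Fin d)

/-- `φ ∈ C_c^∞(Ω)`: smooth, with compact support contained in `Ω`. -/
structure IsTestFunction {d : ℕ} (Ω : Set (Sp d)) (φ : Sp d → ℝ) : Prop where
  smooth : ContDiff ℝ ∞ φ
  hasCompactSupport : HasCompactSupport φ
  tsupport_subset : tsupport φ ⊆ Ω

/-- `y ∈ H¹(Ω)` with weak gradient `G`: both are square integrable on `Ω`, and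
`∫_Ω y ∇φ dx = - ∫_Ω φ G dx` for all test functions `φ` (an identity in `ℝᵈ`). -/
structure HasH1Gradient {d : ℕ} (Ω : Set (Sp d)) (y : Sp d → ℝ) (G : Sp d → Sp d) : Prop where
  memLp : MemLp y 2 (volume.restrict Ω)
  memLp_grad : MemLp G 2 (volume.restrict Ω)
  weak : ∀ φ : Sp d → ℝ, IsTestFunction Ω φ →
    ∫ x in Ω, y x • gradient φ x = - ∫ x in Ω, φ x • G x

/-- `y ∈ H¹₀(Ω)` with weak gradient `G`: `y` lies in `H¹(Ω)` and in the closure of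
`C_c^∞(Ω)` with respect to the `H¹(Ω)` norm. -/
structure HasH10Gradient {d : ℕ} (Ω : Set (Sp d)) (y : Sp d → ℝ) (G : Sp d → Sp d) : Prop
    extends HasH1Gradient Ω y G where
  approx : ∀ ε : ℝ, 0 < ε → ∃ φ : Sp d → ℝ, IsTestFunction Ω φ ∧
    eLpNorm (fun x => y x - φ x) 2 (volume.restrict Ω) ≤ ENNReal.ofReal ε ∧
    eLpNorm (fun x => G x - gradient φ x) 2 (volume.restrict Ω) ≤ ENNReal.ofReal ε

/-- `y ∈ H¹₀(Ω)` is a weak solution of `-Δ y = f` in `Ω`, `y = 0` on `∂Ω`: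
`∫_Ω ∇y · ∇v dx = ∫_Ω f v dx` for all `v ∈ H¹₀(Ω)`. -/
def IsWeakSolution {d : ℕ} (Ω : Set (Sp d)) (f y : Sp d → ℝ) : Prop :=
  ∃ G : Sp d → Sp d, HasH10Gradient Ω y G ∧
    ∀ (v : Sp d → ℝ) (Gv : Sp d → Sp d), HasH10Gradient Ω v Gv →
      ∫ x in Ω, inner ℝ (G x) (Gv x) = ∫ x in Ω, f x * v x

/-- The standing assumptions on the control cost `g : ℝ → ℝ ∪ {+∞}`: it is proper, lower
semicontinuous, and `g(v) / |v| → +∞` as `|v| → ∞`. -/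
structure IsControlCost (g : ℝ → EReal) : Prop where
  ne_bot : ∀ v, g v ≠ ⊥
  proper : ∃ v, g v ≠ ⊤
  lsc : LowerSemicontinuous g
  superlinear : Tendsto (fun v : ℝ => g v / ((|v| : ℝ) : EReal)) (cocompact ℝ) (𝓝 ⊤)

/-- The control `u` is feasible: `∫_Ω g(u) dx` exists as a real number, that is, `g ∘ u` is finite
almost everywhere in `Ω` and integrable on `Ω`. -/
structure IsFeasible {d : ℕ} (Ω : Set (Sp d)) (g : ℝ → EReal) (u : Sp d → ℝ) : Prop where
  ae_finite : ∀ᵐ x ∂(volume.restrict Ω), g (u x) ≠ ⊤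
  integrable : Integrable (fun x => (g (u x)).toReal) (volume.restrict Ω)

/-- The cost functional `J(y,u) = ½ ‖y - y_d‖²_{L²(Ω)} + ∫_Ω g(u) dx`, for `y, y_d ∈ L²(Ω)` and
a feasible control `u`. -/
noncomputable def J {d : ℕ} (Ω : Set (Sp d)) (g : ℝ → EReal) (yd y u : Sp d → ℝ) : ℝ :=
  1 / 2 * (eLpNorm (fun x => y x - yd x) 2 (volume.restrict Ω)).toReal ^ 2
    + ∫ x in Ω, (g (u x)).toReal

/-- The perturbed control `u_B = u + χ_B (ũ - u)`. -/
noncomputable def perturb {d : ℕ} (u ut : Sp d → ℝ) (B : Set (Sp d)) : Sp d → ℝ :=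
  fun x => u x + B.indicator (fun z => ut z - u z) x

end EllipticControl

namespace EllipticControl

open scoped ENNReal NNReal

/-! Put `z = y_B - y` and `h = ũ - u`. The tracking term is quadratic, so its increment is exactly
`(y - y_d, z) + ½‖z‖²` in `L²(Ω)`. Testing the adjoint equation with `z`, and the equation `-Δz =
χ_B h` with `p`, turns the linear term into `∫_B h p`. The increment of the control cost lives on
`B`. Only `½‖z‖²` remains.

For it, test the equation of `z` with `z` itself. Hölder's inequality on `B` and a Sobolev
inequality `‖z‖_q ≤ K‖∇z‖₂` with `q > 2` give `‖∇z‖₂² ≤ ‖h‖_∞ |B|^(1-1/q) K ‖∇z‖₂`. Cancelling,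
squaring and using `‖z‖₂ ≤ D‖∇z‖₂` produces `|B|^(2-2/q)`, so `γ = 1 - 2/q`. Any `q > 2` suffices
(`exists_sobolev_testFunction`, `exists_eLpNorm_sq_le_of_indicator_source`). -/

theorem norm_gradient_eq_norm_fderiv {d : ℕ} (φ : Sp d → ℝ) (x : Sp d) :
    ‖gradient φ x‖ = ‖fderiv ℝ φ x‖ := by
  simp [gradient]

theorem eLpNorm_fderiv_eq_eLpNorm_gradient {d : ℕ} (φ : Sp d → ℝ) (p : ℝ≥0∞)
    (μ : Measure (Sp d)) :
    eLpNorm (fderiv ℝ φ) p μ = eLpNorm (gradient φ) p μ :=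
  eLpNorm_congr_norm_ae (ae_of_all _ fun x => (norm_gradient_eq_norm_fderiv φ x).symm)

/-! ### Test functions -/

namespace IsTestFunction

variable {d : ℕ} {Ω : Set (Sp d)} {φ : Sp d → ℝ}

theorem support_subset (hφ : IsTestFunction Ω φ) : φ.support ⊆ Ω :=
  (subset_tsupport φ).trans hφ.tsupport_subset

theorem support_fderiv_subset (hφ : IsTestFunction Ω φ) : (fderiv ℝ φ).support ⊆ Ω :=
  (_root_.support_fderiv_subset ℝ).trans hφ.tsupport_subset

theorem continuous_gradient (hφ : IsTestFunction Ω φ) : Continuous (gradient φ) :=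
  (InnerProductSpace.toDual ℝ (Sp d)).symm.continuous.comp
    (hφ.smooth.continuous_fderiv (by simp))

theorem add {ψ : Sp d → ℝ} (hφ : IsTestFunction Ω φ) (hψ : IsTestFunction Ω ψ) :
    IsTestFunction Ω (φ + ψ) where
  smooth := hφ.smooth.add hψ.smooth
  hasCompactSupport := hφ.hasCompactSupport.add hψ.hasCompactSupport
  tsupport_subset := (tsupport_add φ ψ).trans
    (Set.union_subset hφ.tsupport_subset hψ.tsupport_subset)

theorem neg (hφ : IsTestFunction Ω φ) : IsTestFunction Ω (-φ) where
  smooth := hφ.smooth.neg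
  hasCompactSupport := hφ.hasCompactSupport.neg
  tsupport_subset := by
    have : tsupport (-φ) = tsupport φ := by simp [tsupport, Function.support_neg]
    rw [this]
    exact hφ.tsupport_subset

theorem sub {ψ : Sp d → ℝ} (hφ : IsTestFunction Ω φ) (hψ : IsTestFunction Ω ψ) :
    IsTestFunction Ω (φ - ψ) := by
  rw [sub_eq_add_neg]
  exact hφ.add hψ.neg

theorem gradient_sub {ψ : Sp d → ℝ} (hφ : IsTestFunction Ω φ) (hψ : IsTestFunction Ω ψ)
    (x : Sp d) : gradient (φ - ψ) x = gradient φ x - gradient ψ x := by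
  have h1 := (hφ.smooth.differentiable (by simp)).differentiableAt (x := x)
  have h2 := (hψ.smooth.differentiable (by simp)).differentiableAt (x := x)
  simp [gradient, fderiv_sub h1 h2]

theorem memLp_gradient_restrict (hφ : IsTestFunction Ω φ) (p : ℝ≥0∞) :
    MemLp (gradient φ) p (volume.restrict Ω) := by
  have h : HasCompactSupport (gradient φ) := by
    refine (hφ.hasCompactSupport.fderiv (𝕜 := ℝ)).comp_left
      (g := (InnerProductSpace.toDual ℝ (Sp d)).symm) (by simp)
  exact (hφ.continuous_gradient.memLp_of_hasCompactSupport h).restrict Ω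

theorem memLp_restrict (hφ : IsTestFunction Ω φ) (p : ℝ≥0∞) :
    MemLp φ p (volume.restrict Ω) :=
  (hφ.smooth.continuous.memLp_of_hasCompactSupport hφ.hasCompactSupport).restrict Ω

end IsTestFunction

/-! ### Sobolev inequality for test functions -/

/-- A compactly supported `C¹` function on the line is bounded by the `L¹` norm of its
derivative. -/
theorem enorm_le_eLpNorm_one_fderiv_of_dim_one {φ : Sp 1 → ℝ} (hφ : ContDiff ℝ 1 φ)
    (hc : HasCompactSupport φ) (x : Sp 1) : ‖φ x‖ₑ ≤ eLpNorm (fderiv ℝ φ) 1 volume := by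
  let b := OrthonormalBasis.singleton (Fin 1) ℝ
  let L : ℝ ≃ₗᵢ[ℝ] Sp 1 := b.repr
  have hL : MeasurePreserving L volume volume := b.measurePreserving_repr
  have hψ : ContDiff ℝ 1 (φ ∘ L) := hφ.comp L.contDiff
  have hψc : HasCompactSupport (φ ∘ L) :=
    hc.comp_homeomorph L.toHomeomorph
  have h := HasCompactSupport.enorm_le_lintegral_Ici_deriv hψ hψc (L.symm x)
  have hd : ∀ t, ‖deriv (φ ∘ L) t‖ₑ ≤ ‖fderiv ℝ φ (L t)‖ₑ := by
    intro t
    have h1 : HasDerivAt L (L 1) t := by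
      simpa using L.toContinuousLinearEquiv.toContinuousLinearMap.hasDerivAt (x := t)
    have h2 := ((hφ.differentiable (by simp)).differentiableAt
      (x := L t)).hasFDerivAt.comp_hasDerivAt t h1
    rw [h2.deriv]
    refine (ContinuousLinearMap.le_opENorm _ _).trans ?_
    have : ‖L 1‖ₑ = 1 := by
      rw [← ofReal_norm, L.norm_map]; simp
    rw [this, mul_one]
  calc ‖φ x‖ₑ = ‖(φ ∘ L) (L.symm x)‖ₑ := by simp
    _ ≤ ∫⁻ t in Set.Iic (L.symm x), ‖deriv (φ ∘ L) t‖ₑ := h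
    _ ≤ ∫⁻ t, ‖deriv (φ ∘ L) t‖ₑ := setLIntegral_le_lintegral _ _
    _ ≤ ∫⁻ t, ‖fderiv ℝ φ (L t)‖ₑ := lintegral_mono hd
    _ = ∫⁻ y, ‖fderiv ℝ φ y‖ₑ :=
      hL.lintegral_comp_emb L.toHomeomorph.measurableEmbedding fun y => ‖fderiv ℝ φ y‖ₑ
    _ = eLpNorm (fderiv ℝ φ) 1 volume := eLpNorm_one_eq_lintegral_enorm.symm

/-- On a bounded set, comparison of `Lᵖ` norms for `p ≤ 2`. -/
theorem eLpNorm_fderiv_le_eLpNorm_gradient_two {d : ℕ} {Ω : Set (Sp d)} {φ : Sp d → ℝ}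
    (hφ : IsTestFunction Ω φ) {p : ℝ≥0∞} (hp : p ≤ 2) :
    eLpNorm (fderiv ℝ φ) p volume ≤
      volume Ω ^ (1 / p.toReal - 1 / (2 : ℝ≥0∞).toReal)
        * eLpNorm (gradient φ) 2 (volume.restrict Ω) := by
  rw [← eLpNorm_restrict_eq_of_support_subset (f := fderiv ℝ φ) hφ.support_fderiv_subset,
    eLpNorm_fderiv_eq_eLpNorm_gradient, mul_comm]
  simpa using eLpNorm_le_eLpNorm_mul_rpow_measure_univ hp
    (hφ.continuous_gradient.aestronglyMeasurable (μ := volume.restrict Ω))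

/-- Sobolev inequality with some exponent `q > 2`, for test functions on a bounded set. -/
theorem exists_sobolev_testFunction {d : ℕ} (hd : 1 ≤ d) {Ω : Set (Sp d)}
    (hΩ : Bornology.IsBounded Ω) :
    ∃ (q K : ℝ≥0), 2 < q ∧ ∀ φ, IsTestFunction Ω φ →
      eLpNorm φ q (volume.restrict Ω) ≤ K * eLpNorm (gradient φ) 2 (volume.restrict Ω) := by
  have hvol : volume Ω ≠ ⊤ := hΩ.measure_lt_top.ne
  rcases hd.eq_or_lt with rfl | hd
  -- On the line `φ` is bounded by `‖φ'‖₁`, so any finite `q > 2` would do. The factor `|Ω|^(1/3)`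
  -- passes from the sup bound to `L³`, and `|Ω|^(1/2)` from `L¹` to `L²` of the gradient.
  · refine ⟨3, ((volume Ω ^ (1 / 3 : ℝ)) * volume Ω ^ (1 / 2 : ℝ)).toNNReal, by norm_num,
      fun φ hφ => ?_⟩
    rw [ENNReal.coe_toNNReal (ENNReal.mul_ne_top
      (ENNReal.rpow_ne_top_of_nonneg (by norm_num) hvol)
      (ENNReal.rpow_ne_top_of_nonneg (by norm_num) hvol))]
    have h1 := eLpNorm_le_of_ae_enorm_bound (p := ((3 : ℝ≥0) : ℝ≥0∞)) (μ := volume.restrict Ω)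
      (ae_of_all _ (enorm_le_eLpNorm_one_fderiv_of_dim_one (hφ.smooth.of_le (by simp))
        hφ.hasCompactSupport))
    have h2 := eLpNorm_fderiv_le_eLpNorm_gradient_two hφ (p := 1) (by norm_num)
    have e1 : (1 / (1 : ℝ≥0∞).toReal - 1 / (2 : ℝ≥0∞).toReal) = (1 / 2 : ℝ) := by norm_num
    have e2 : (((3 : ℝ≥0) : ℝ≥0∞).toReal⁻¹) = (1 / 3 : ℝ) := by norm_num
    rw [e1] at h2
    rw [e2, Measure.restrict_apply_univ, smul_eq_mul] at h1
    refine h1.trans ((mul_le_mul_left h2 _).trans_eq ?_)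
    ring
  · have hd' : (2 : ℝ) ≤ d := by exact_mod_cast hd
    have hd0 : (0 : ℝ) < d := by linarith
    -- Taking `p < 2 ≤ d` keeps Gagliardo–Nirenberg–Sobolev strictly subcritical even for `d = 2`.
    -- Here `q` is the Sobolev conjugate, `1/q = 1/p - 1/d`, and still exceeds 2.
    let p : ℝ≥0 := ⟨2 * d / (d + 1), by positivity⟩
    let q : ℝ≥0 := ⟨2 * d / (d - 1), div_nonneg (by positivity) (by linarith)⟩
    have hp : (p : ℝ) = 2 * d / (d + 1) := rfl
    have hq : (q : ℝ) = 2 * d / (d - 1) := rfl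
    have hp2 : (p : ℝ≥0∞) ≤ 2 := by
      have : p ≤ 2 := by
        rw [← NNReal.coe_le_coe, hp, div_le_iff₀ (by positivity)]
        push_cast
        linarith
      exact_mod_cast this
    have hp1 : 1 ≤ p := by
      rw [← NNReal.coe_le_coe, hp, le_div_iff₀ (by positivity)]
      push_cast
      linarith
    have hpd : p < Module.finrank ℝ (Sp d) := by
      rw [← NNReal.coe_lt_coe, hp, div_lt_iff₀ (by positivity)]
      simp only [finrank_euclideanSpace, Fintype.card_fin, NNReal.coe_natCast]
      nlinarith
    have hpq : (p : ℝ)⁻¹ - (Module.finrank ℝ (Sp d) : ℝ)⁻¹ ≤ (q : ℝ)⁻¹ := by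
      rw [hp, hq]
      simp only [finrank_euclideanSpace, Fintype.card_fin]
      apply le_of_eq
      have : (d : ℝ) - 1 ≠ 0 := by linarith
      field_simp
      ring
    have he : 0 ≤ 1 / (p : ℝ≥0∞).toReal - 1 / (2 : ℝ≥0∞).toReal := by
      rw [sub_nonneg]
      exact one_div_le_one_div_of_le (by simpa using zero_lt_one.trans_le hp1)
        (ENNReal.toReal_mono (by simp) hp2)
    refine ⟨q, eLpNormLESNormFDerivOfLeConst ℝ (volume : Measure (Sp d)) Ω p q
      * (volume Ω ^ (1 / (p : ℝ≥0∞).toReal - 1 / (2 : ℝ≥0∞).toReal)).toNNReal, ?_,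
      fun φ hφ => ?_⟩
    · rw [← NNReal.coe_lt_coe, hq, lt_div_iff₀ (by linarith)]
      push_cast
      linarith
    · rw [ENNReal.coe_mul, ENNReal.coe_toNNReal (ENNReal.rpow_ne_top_of_nonneg he hvol),
        eLpNorm_restrict_eq_of_support_subset hφ.support_subset, mul_assoc]
      refine (eLpNorm_le_eLpNorm_fderiv_of_le (F := ℝ) volume (hφ.smooth.of_le (by simp))
        hφ.support_subset hp1 hpd hpq hΩ).trans ?_
      exact mul_le_mul_right (eLpNorm_fderiv_le_eLpNorm_gradient_two hφ hp2) _

/-! ### Square-integrable functions and `H¹₀(Ω)` -/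

theorem integrable_inner_of_memLp_two {α E : Type*} [MeasurableSpace α] {μ : Measure α}
    [NormedAddCommGroup E] [InnerProductSpace ℝ E] {F G : α → E} (hF : MemLp F 2 μ)
    (hG : MemLp G 2 μ) : Integrable (fun x => inner ℝ (F x) (G x)) μ := by
  refine (hF.norm.integrable_mul hG.norm).mono' (hF.1.inner hG.1) (ae_of_all _ fun x => ?_)
  exact norm_inner_le_norm _ _

theorem toReal_eLpNorm_two_sq {α E : Type*} [MeasurableSpace α] {μ : Measure α}
    [NormedAddCommGroup E] {F : α → E} (hF : MemLp F 2 μ) :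
    (eLpNorm F 2 μ).toReal ^ 2 = ∫ x, ‖F x‖ ^ 2 ∂μ := by
  have h0 : 0 ≤ ∫ x, ‖F x‖ ^ 2 ∂μ := integral_nonneg fun x => by positivity
  rw [hF.eLpNorm_eq_integral_rpow_norm (by simp) (by simp),
    ENNReal.toReal_ofReal (Real.rpow_nonneg (integral_nonneg fun x => by positivity) _)]
  simp only [ENNReal.toReal_ofNat, Real.rpow_ofNat]
  rw [← Real.rpow_natCast, ← Real.rpow_mul h0]
  norm_num

namespace HasH10Gradient

variable {d : ℕ} {Ω : Set (Sp d)} {y z : Sp d → ℝ} {G H : Sp d → Sp d}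

theorem sub (hy : HasH10Gradient Ω y G) (hz : HasH10Gradient Ω z H) :
    HasH10Gradient Ω (y - z) (G - H) where
  memLp := hy.memLp.sub hz.memLp
  memLp_grad := hy.memLp_grad.sub hz.memLp_grad
  weak φ hφ := by
    have hg := hφ.memLp_gradient_restrict 2
    have hp := hφ.memLp_restrict 2
    have i1 : Integrable (y • gradient φ) (volume.restrict Ω) :=
      memLp_one_iff_integrable.1 (hg.smul hy.memLp)
    have i2 : Integrable (z • gradient φ) (volume.restrict Ω) :=
      memLp_one_iff_integrable.1 (hg.smul hz.memLp)
    have i3 : Integrable (φ • G) (volume.restrict Ω) :=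
      memLp_one_iff_integrable.1 (hy.memLp_grad.smul hp)
    have i4 : Integrable (φ • H) (volume.restrict Ω) :=
      memLp_one_iff_integrable.1 (hz.memLp_grad.smul hp)
    have e1 := integral_sub i1 i2
    have e2 := integral_sub i3 i4
    simp only [Pi.smul_apply', Pi.sub_apply, sub_smul, smul_sub] at e1 e2 ⊢
    rw [e1, e2, hy.weak φ hφ, hz.weak φ hφ]
    abel
  approx ε hε := by
    obtain ⟨φ, hφ, a1, a2⟩ := hy.approx (ε / 2) (by positivity)
    obtain ⟨ψ, hψ, b1, b2⟩ := hz.approx (ε / 2) (by positivity)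
    have hadd : ENNReal.ofReal (ε / 2) + ENNReal.ofReal (ε / 2) = ENNReal.ofReal ε := by
      rw [← ENNReal.ofReal_add (by positivity) (by positivity), add_halves]
    refine ⟨φ - ψ, hφ.sub hψ, ?_, ?_⟩
    · have e : (fun x => (y - z) x - (φ - ψ) x) = (fun x => y x - φ x) - fun x => z x - ψ x := by
        ext x
        simp only [Pi.sub_apply]
        ring
      rw [e, ← hadd]
      exact (eLpNorm_sub_le (hy.memLp.sub (hφ.memLp_restrict 2)).1
        (hz.memLp.sub (hψ.memLp_restrict 2)).1 (by norm_num)).trans (add_le_add a1 b1)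
    · have e : (fun x => (G - H) x - gradient (φ - ψ) x)
          = (fun x => G x - gradient φ x) - fun x => H x - gradient ψ x := by
        funext x
        simp only [Pi.sub_apply, hφ.gradient_sub hψ]
        abel
      rw [e, ← hadd]
      exact (eLpNorm_sub_le (hy.memLp_grad.sub (hφ.memLp_gradient_restrict 2)).1
        (hz.memLp_grad.sub (hψ.memLp_gradient_restrict 2)).1 (by norm_num)).trans
        (add_le_add a2 b2)

/-- A Sobolev inequality for test functions extends to `H¹₀(Ω)`. -/
theorem eLpNorm_le_of_testFunction {q : ℝ≥0∞} {K : ℝ≥0}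
    (hK : ∀ φ, IsTestFunction Ω φ →
      eLpNorm φ q (volume.restrict Ω) ≤ K * eLpNorm (gradient φ) 2 (volume.restrict Ω))
    (hy : HasH10Gradient Ω y G) :
    eLpNorm y q (volume.restrict Ω) ≤ K * eLpNorm G 2 (volume.restrict Ω) := by
  choose φ hφ h1 h2 using fun n : ℕ => hy.approx (1 / ((n : ℝ) + 1)) (by positivity)
  have hlim : Tendsto (fun n : ℕ => ENNReal.ofReal (1 / ((n : ℝ) + 1))) atTop (𝓝 0) := by
    simpa using ENNReal.tendsto_ofReal tendsto_one_div_add_atTop_nhds_zero_nat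
  -- Convergence in `L²` gives convergence in measure, under which the `L^q` norm is lower
  -- semicontinuous (Fatou). No prior knowledge that `y ∈ L^q` is needed.
  have hmeas : TendstoInMeasure (volume.restrict Ω) φ atTop y := by
    refine tendstoInMeasure_of_tendsto_eLpNorm (p := 2) (by norm_num)
      (fun n => ((hφ n).memLp_restrict 2).1) hy.memLp.1 ?_
    refine tendsto_of_tendsto_of_tendsto_of_le_of_le tendsto_const_nhds hlim
      (fun _ => bot_le) fun n => ?_
    rw [eLpNorm_sub_comm]
    exact h1 n
  have hbound : ∀ n : ℕ, eLpNorm (gradient (φ n)) 2 (volume.restrict Ω)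
      ≤ eLpNorm G 2 (volume.restrict Ω) + ENNReal.ofReal (1 / ((n : ℝ) + 1)) := by
    intro n
    have e : gradient (φ n) = G - fun x => G x - gradient (φ n) x := by
      funext x
      simp
    rw [e]
    refine (eLpNorm_sub_le hy.memLp_grad.1
      (hy.memLp_grad.sub ((hφ n).memLp_gradient_restrict 2)).1 (by norm_num)).trans ?_
    gcongr
    exact h2 n
  have hlim' : Tendsto (fun n : ℕ => (K : ℝ≥0∞) * (eLpNorm G 2 (volume.restrict Ω)
      + ENNReal.ofReal (1 / ((n : ℝ) + 1)))) atTop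
      (𝓝 (K * eLpNorm G 2 (volume.restrict Ω))) := by
    refine ENNReal.Tendsto.const_mul ?_ (Or.inr ENNReal.coe_ne_top)
    simpa using tendsto_const_nhds.add hlim
  -- For fixed `m`, the `m`-th bound dominates all later approximants, hence also the limit `y`;
  -- then `m → ∞`.
  refine ge_of_tendsto' hlim' fun m => ?_
  refine eLpNorm_le_of_tendstoInMeasure (f := φ) (u := atTop) ?_ hmeas
    (fun n => ((hφ n).memLp_restrict 2).1)
  filter_upwards [eventually_ge_atTop m] with n hn
  refine (hK _ (hφ n)).trans ?_
  gcongr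
  refine (hbound n).trans ?_
  gcongr

end HasH10Gradient

/-! ### Energy estimate for a source supported on `B` -/

/-- Energy estimate: the solution with right-hand side `χ_B h` is controlled by a power larger
than one half of the measure of `B`. -/
theorem exists_eLpNorm_sq_le_of_indicator_source {d : ℕ} (hd : 1 ≤ d) {Ω : Set (Sp d)}
    (hΩ : Bornology.IsBounded Ω) :
    ∃ γ c : ℝ, 0 < γ ∧ 0 < c ∧ ∀ (h z : Sp d → ℝ) (G : Sp d → Sp d) (B : Set (Sp d)),
      MemLp h ⊤ (volume.restrict Ω) → B ⊆ Ω → HasH10Gradient Ω z G →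
      ∫ x in Ω, inner ℝ (G x) (G x) = ∫ x in B, h x * z x →
      (eLpNorm z 2 (volume.restrict Ω)).toReal ^ 2 ≤ c * (volume B).toReal ^ (1 + γ)
        * (eLpNorm h ⊤ (volume.restrict Ω)).toReal ^ 2 := by
  obtain ⟨q, K, hq, hK⟩ := exists_sobolev_testFunction hd hΩ
  have hvol : volume Ω ≠ ⊤ := hΩ.measure_lt_top.ne
  have hq' : (2 : ℝ) < q := by exact_mod_cast hq
  have hq2 : (2 : ℝ≥0∞) ≤ q := by exact_mod_cast hq.le
  have hs : (0 : ℝ) ≤ 1 / 2 - 1 / q := by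
    rw [sub_nonneg]
    exact one_div_le_one_div_of_le (by norm_num) hq'.le
  have ht : (0 : ℝ) ≤ 1 - 1 / q := by linarith
  set D : ℝ := (K : ℝ) * (volume Ω).toReal ^ (1 / 2 - 1 / (q : ℝ)) with hD
  have hD0 : 0 ≤ D := by positivity
  have hγ : 2 / (q : ℝ) < 1 := by rwa [div_lt_one (by linarith)]
  -- The summand 1 only makes the constant positive when `K` or `D` vanishes.
  refine ⟨1 - 2 / q, D ^ 2 * K ^ 2 + 1, by linarith, by positivity, ?_⟩
  intro h z G B hh hB hz hE
  have hzq := HasH10Gradient.eLpNorm_le_of_testFunction hK hz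
  set N := (eLpNorm G 2 (volume.restrict Ω)).toReal with hN
  set M := (eLpNorm h ⊤ (volume.restrict Ω)).toReal with hM
  set b := (volume B).toReal with hb
  have hN0 : 0 ≤ N := ENNReal.toReal_nonneg
  have hM0 : 0 ≤ M := ENNReal.toReal_nonneg
  have hb0 : 0 ≤ b := ENNReal.toReal_nonneg
  have hvB : volume B ≠ ⊤ := ((measure_mono hB).trans_lt hΩ.measure_lt_top).ne
  have hpoinc : (eLpNorm z 2 (volume.restrict Ω)).toReal ≤ D * N := by
    have h1 := (eLpNorm_le_eLpNorm_mul_rpow_measure_univ hq2 hz.memLp.1).trans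
      (mul_le_mul_left hzq _)
    rw [Measure.restrict_apply_univ, ENNReal.toReal_ofNat, ENNReal.coe_toReal] at h1
    have h2 := ENNReal.toReal_mono (ENNReal.mul_ne_top (ENNReal.mul_ne_top ENNReal.coe_ne_top
      hz.memLp_grad.2.ne) (ENNReal.rpow_ne_top_of_nonneg hs hvol)) h1
    rw [ENNReal.toReal_mul, ENNReal.toReal_mul, ← ENNReal.toReal_rpow, ENNReal.coe_toReal] at h2
    rw [hD]
    linarith
  have hmono : volume.restrict B ≤ volume.restrict Ω := Measure.restrict_mono hB le_rfl
  have hzB : AEStronglyMeasurable z (volume.restrict B) := hz.memLp.1.mono_measure hmono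
  have hhB : AEStronglyMeasurable h (volume.restrict B) := hh.1.mono_measure hmono
  have hz1 : eLpNorm z 1 (volume.restrict B) ≤
      K * eLpNorm G 2 (volume.restrict Ω) * volume B ^ (1 - 1 / (q : ℝ)) := by
    have h1 := eLpNorm_le_eLpNorm_mul_rpow_measure_univ
      ((by norm_num : (1 : ℝ≥0∞) ≤ 2).trans hq2) hzB
    rw [Measure.restrict_apply_univ, ENNReal.toReal_one, ENNReal.coe_toReal, div_one] at h1
    exact h1.trans (mul_le_mul_left ((eLpNorm_mono_measure z hmono).trans hzq) _)
  have henergy : N ^ 2 ≤ M * (K * N * b ^ (1 - 1 / (q : ℝ))) := by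
    have h1 : ‖∫ x in B, h x * z x‖ₑ ≤ eLpNorm h ⊤ (volume.restrict Ω) *
        (K * eLpNorm G 2 (volume.restrict Ω) * volume B ^ (1 - 1 / (q : ℝ))) := by
      refine (enorm_integral_le_lintegral_enorm _).trans ?_
      rw [← eLpNorm_one_eq_lintegral_enorm]
      exact (eLpNorm_smul_le_mul_eLpNorm (p := ⊤) (q := 1) (r := 1) hzB hhB).trans
        (mul_le_mul' (eLpNorm_mono_measure h hmono) hz1)
    have h2 := ENNReal.toReal_mono (ENNReal.mul_ne_top hh.2.ne
      (ENNReal.mul_ne_top (ENNReal.mul_ne_top ENNReal.coe_ne_top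
        hz.memLp_grad.2.ne) (ENNReal.rpow_ne_top_of_nonneg ht hvB))) h1
    rw [ENNReal.toReal_mul, ENNReal.toReal_mul, ENNReal.toReal_mul, ← ENNReal.toReal_rpow,
      ENNReal.coe_toReal, toReal_enorm] at h2
    rw [hN, toReal_eLpNorm_two_sq hz.memLp_grad]
    simp only [← real_inner_self_eq_norm_sq]
    rw [hE]
    exact (le_abs_self _).trans h2
  -- Cancel one factor `N` in the energy bound; `N = 0` is trivial.
  have hN1 : N ≤ M * K * b ^ (1 - 1 / (q : ℝ)) := by
    rcases hN0.eq_or_lt with h0 | h0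
    · rw [← h0]
      positivity
    · refine le_of_mul_le_mul_right ?_ h0
      nlinarith
  have hpow : (b ^ (1 - 1 / (q : ℝ))) ^ 2 = b ^ (1 + (1 - 2 / (q : ℝ))) := by
    rw [← Real.rpow_natCast, ← Real.rpow_mul hb0]
    congr 1
    push_cast
    ring
  calc (eLpNorm z 2 (volume.restrict Ω)).toReal ^ 2
      ≤ (D * (M * K * b ^ (1 - 1 / (q : ℝ)))) ^ 2 :=
        pow_le_pow_left₀ ENNReal.toReal_nonneg
          (hpoinc.trans (mul_le_mul_of_nonneg_left hN1 hD0)) 2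
    _ = D ^ 2 * K ^ 2 * (b ^ (1 - 1 / (q : ℝ))) ^ 2 * M ^ 2 := by ring
    _ ≤ (D ^ 2 * K ^ 2 + 1) * b ^ (1 + (1 - 2 / (q : ℝ))) * M ^ 2 := by
        rw [hpow]
        gcongr
        linarith

/-! ### Localization to `B` -/

theorem perturb_eq_add {d : ℕ} (u ut : Sp d → ℝ) (B : Set (Sp d)) :
    perturb u ut B = u + B.indicator (ut - u) := rfl

section Restrict

variable {d : ℕ} {Ω B : Set (Sp d)}

theorem restrict_restrict_of_subset_of_nullMeasurableSet (hB : B ⊆ Ω)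
    (hBm : NullMeasurableSet B volume) :
    ((volume : Measure (Sp d)).restrict Ω).restrict B = volume.restrict B := by
  rw [Measure.restrict_restrict₀ (hBm.mono_ac Measure.restrict_le_self.absolutelyContinuous),
    Set.inter_eq_left.2 hB]

theorem setIntegral_indicator_of_subset (hB : B ⊆ Ω) (hBm : NullMeasurableSet B volume)
    (f : Sp d → ℝ) : ∫ x in Ω, B.indicator f x = ∫ x in B, f x := by
  rw [integral_indicator₀ (hBm.mono_ac Measure.restrict_le_self.absolutelyContinuous),
    restrict_restrict_of_subset_of_nullMeasurableSet hB hBm]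

theorem memLp_indicator_restrict (hBm : NullMeasurableSet B volume) {f : Sp d → ℝ} {p : ℝ≥0∞}
    (hf : MemLp f p (volume.restrict Ω)) : MemLp (B.indicator f) p (volume.restrict Ω) :=
  hf.mono (hf.1.indicator₀ (hBm.mono_ac Measure.restrict_le_self.absolutelyContinuous))
    (ae_of_all _ fun x => norm_indicator_le_norm_self f x)

/-- The change of the control cost under a perturbation of the control is localized to `B`. -/
theorem integral_cost_perturb {g : ℝ → EReal} {u ut : Sp d → ℝ} (hB : B ⊆ Ω)
    (hBm : NullMeasurableSet B volume) (hu : IsFeasible Ω g u) (hut : IsFeasible Ω g ut) :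
    ∫ x in Ω, (g (perturb u ut B x)).toReal = (∫ x in Ω, (g (u x)).toReal)
      + ∫ x in B, ((g (ut x)).toReal - (g (u x)).toReal) := by
  have hi : Integrable (fun x => (g (ut x)).toReal - (g (u x)).toReal) (volume.restrict Ω) :=
    hut.integrable.sub hu.integrable
  rw [← setIntegral_indicator_of_subset hB hBm, ← integral_add hu.integrable
    (hi.indicator₀ (hBm.mono_ac Measure.restrict_le_self.absolutelyContinuous))]
  refine integral_congr_ae (ae_of_all _ fun x => ?_)
  by_cases hx : x ∈ B <;> simp [perturb, hx]

end Restrict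

end EllipticControl

/-! ### Expansion of the cost -/

open EllipticControl in
theorem theorem2p3 {d : ℕ} (hd : 1 ≤ d)
    (Ω : Set (EllipticControl.Sp d)) (hΩ_open : IsOpen Ω) (hΩ_conn : IsConnected Ω)
    (hΩ_bdd : Bornology.IsBounded Ω)
    (g : ℝ → EReal) (hg : EllipticControl.IsControlCost g)
    (yd : EllipticControl.Sp d → ℝ) (hyd : MemLp yd 2 (volume.restrict Ω)) :
    ∃ γ c : ℝ, 0 < γ ∧ 0 < c ∧
      ∀ (u ut : EllipticControl.Sp d → ℝ),
        MemLp u ⊤ (volume.restrict Ω) → MemLp ut ⊤ (volume.restrict Ω) →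
        EllipticControl.IsFeasible Ω g u → EllipticControl.IsFeasible Ω g ut →
      ∀ B : Set (EllipticControl.Sp d), B ⊆ Ω → NullMeasurableSet B volume →
      ∀ y yB p : EllipticControl.Sp d → ℝ,
        EllipticControl.IsWeakSolution Ω u y →
        EllipticControl.IsWeakSolution Ω (EllipticControl.perturb u ut B) yB →
        EllipticControl.IsWeakSolution Ω (fun x => y x - yd x) p →
        EllipticControl.J Ω g yd yB (EllipticControl.perturb u ut B)
            - EllipticControl.J Ω g yd y u
          ≤ (∫ x in B, ((ut x - u x) * p x + (g (ut x)).toReal - (g (u x)).toReal))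
            + c * (volume B).toReal ^ (1 + γ)
              * (eLpNorm (fun x => ut x - u x) ⊤ (volume.restrict Ω)).toReal ^ 2 := by
  obtain ⟨γ, c, hγ, hc, hest⟩ := exists_eLpNorm_sq_le_of_indicator_source hd hΩ_bdd
  refine ⟨γ, c, hγ, hc, ?_⟩
  intro u ut hu hut hfu hfut B hB hBm y yB p ⟨G, hG, hGw⟩ ⟨GB, hGB, hGBw⟩ ⟨Gp, hGp, hGpw⟩
  have hfin : IsFiniteMeasure (volume.restrict Ω) := ⟨by
    rw [Measure.restrict_apply_univ]; exact hΩ_bdd.measure_lt_top⟩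
  have hz := hGB.sub hG
  have hh : MemLp (fun x => ut x - u x) ⊤ (volume.restrict Ω) := hut.sub hu
  have hf : MemLp (B.indicator (ut - u)) 2 (volume.restrict Ω) :=
    memLp_indicator_restrict hBm ((hut.sub hu).mono_exponent le_top)
  have hu2 : MemLp u 2 (volume.restrict Ω) := hu.mono_exponent le_top
  have hzw : ∀ (v : Sp d → ℝ) (Gv : Sp d → Sp d), HasH10Gradient Ω v Gv →
      ∫ x in Ω, inner ℝ ((GB - G) x) (Gv x) = ∫ x in B, (ut x - u x) * v x := by
    intro v Gv hv
    have e1 := hGw v Gv hv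
    have e2 := hGBw v Gv hv
    have e3 := integral_sub (integrable_inner_of_memLp_two hGB.memLp_grad hv.memLp_grad)
      (integrable_inner_of_memLp_two hG.memLp_grad hv.memLp_grad)
    have e4 := integral_add (hu2.integrable_mul hv.memLp) (hf.integrable_mul hv.memLp)
    have e5 : ∫ x in Ω, (B.indicator (ut - u) * v) x = ∫ x in B, (ut x - u x) * v x := by
      rw [← setIntegral_indicator_of_subset hB hBm]
      refine integral_congr_ae (ae_of_all _ fun x => ?_)
      by_cases hx : x ∈ B <;> simp [hx]
    have e6 : ∫ x in Ω, perturb u ut B x * v x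
        = ∫ x in Ω, ((u * v) x + (B.indicator (ut - u) * v) x) := by
      refine integral_congr_ae (ae_of_all _ fun x => ?_)
      simp only [perturb_eq_add, Pi.add_apply, Pi.mul_apply]
      ring
    simp only [Pi.sub_apply, inner_sub_left]
    rw [e3, e1, e2, e6, e4, e5]
    simp
  have hmain := hest _ _ _ B hh hB hz (hzw _ _ hz)
  -- Both sides equal `∫ ∇p · ∇z`: `z` is admissible in the equation of `p`, and `p` in that of `z`.
  have hadj : ∫ x in Ω, (y x - yd x) * (yB - y) x = ∫ x in B, (ut x - u x) * p x := by
    rw [← hGpw _ _ hz, ← hzw _ _ hGp]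
    simp only [real_inner_comm]
  have hr : MemLp (fun x => y x - yd x) 2 (volume.restrict Ω) := hG.memLp.sub hyd
  have hrB : MemLp (fun x => yB x - yd x) 2 (volume.restrict Ω) := hGB.memLp.sub hyd
  have hquad : ∫ x in Ω, ‖yB x - yd x‖ ^ 2 = (∫ x in Ω, ‖y x - yd x‖ ^ 2)
      + (∫ x in Ω, ‖(yB - y) x‖ ^ 2) + 2 * ∫ x in Ω, (y x - yd x) * (yB - y) x := by
    have i1 := hr.integrable_sq
    have i2 := hz.memLp.integrable_sq
    have i3 : Integrable (fun x => (y x - yd x) * (yB - y) x) (volume.restrict Ω) :=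
      hr.integrable_mul hz.memLp
    have i4 : Integrable (fun x => (y x - yd x) ^ 2 + (yB - y) x ^ 2) (volume.restrict Ω) :=
      i1.add i2
    simp only [Real.norm_eq_abs, sq_abs]
    rw [← integral_const_mul, ← integral_add i1 i2, ← integral_add i4 (i3.const_mul 2)]
    refine integral_congr_ae (ae_of_all _ fun x => ?_)
    simp only [Pi.sub_apply]
    ring
  have hmono : volume.restrict B ≤ volume.restrict Ω := Measure.restrict_mono hB le_rfl
  have hsplit : ∫ x in B, ((ut x - u x) * p x + (g (ut x)).toReal - (g (u x)).toReal)
      = (∫ x in B, (ut x - u x) * p x)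
        + ∫ x in B, ((g (ut x)).toReal - (g (u x)).toReal) := by
    have i1 : Integrable (fun x => (ut x - u x) * p x) (volume.restrict Ω) :=
      (hh.mono_exponent le_top : MemLp _ 2 _).integrable_mul hGp.memLp
    have i2 : Integrable (fun x => (g (ut x)).toReal - (g (u x)).toReal) (volume.restrict Ω) :=
      hfut.integrable.sub hfu.integrable
    rw [← integral_add (i1.mono_measure hmono) (i2.mono_measure hmono)]
    simp only [add_sub_assoc]
  rw [J, J, toReal_eLpNorm_two_sq hr, toReal_eLpNorm_two_sq hrB, hquad, hsplit,
    integral_cost_perturb hB hBm hfu hfut, hadj]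
  rw [toReal_eLpNorm_two_sq hz.memLp] at hmain
  -- Nonnegativity lets `½‖z‖²` be bounded by `‖z‖²`, so `c` needs no halving.
  have h0 : 0 ≤ ∫ x in Ω, ‖(yB - y) x‖ ^ 2 := integral_nonneg fun x => by positivity
  linarith
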